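/- Let $n>1$ and $a\in\mathbb{Z}$, and let $\Delta^n\times\Delta^1$ have the facets $F_i\times\Delta^1$ ($1\le i\le n+1$) and $\Delta^n\times G_j$ ($j=1,2$), where the $F_i$ and $G_j$ are the facets of $\Delta^n$ and $\Delta^1$. For $\mathbf{b}=(b_1,\dots,b_n)\in\mathbb{Z}^n$ define facet vectors in $\mathbb{Z}^{n+1}$ by $\lambda(F_i\times\Delta^1)=\mathbf{e}_i$ for $1\le i\le n$, $\lambda(F_{n+1}\times\Delta^1)=(-1,\dots,-1,-a)$, $\lambda(\Delta^n\times G_1)=\mathbf{e}_{n+1}$ and $\lambda(\Delta^n\times G_2)=(-b_1,\dots,-b_n,-1)$. Let $T^{n+1}=(S^1)^{n+1}$ and $$M_{a,\mathbf{b}}=T^{n+1}\times(\Delta^n\times\Delta^1)/\!\sim,$$ with the quotient topology, where $(t,p)\sim(s,q)$ if and only if $p=q$ and $t^{-1}s$ lies in the subgroup of $T^{n+1}$ generated by the circles $\{(z^{v_1},\dots,z^{v_{n+1}}): z\in S^1\}$, $v=\lambda(F)$, for the facets $F$ containing $p$. Let $b\in\mathbb{Z}$ with $ab=2$. Then: 1.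 $M_{a,(b,0,\dots,0)}$ is homeomorphic to $M_{a,(b,\dots,b)}$. 2. Let $\mathbf{b}\in\{0,b\}^n$ have exactly $s$ entries equal to $b$. Then $M_{a,\mathbf{b}}$ is homeomorphic to $M_{a,\mathbf{0}}$ if $s$ is even, and to $M_{a,(b,0,\dots,0)}$ if $s$ is odd. In particular, if $n$ is even, then $M_{a,\mathbf{b}}$ is homeomorphic to $M_{a,\mathbf{0}}$ for every $\mathbf{b}\in\{0,b\}^n$. -/

import Mathlib

/-- The one-parameter subgroup `t ↦ (t ^ v₁, …, t ^ v_k)` of the torus `κ → Circle`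
given by an integer vector `v`. -/
noncomputable def oneParam {κ : Type*} (v : κ → ℤ) : Circle →* (κ → Circle) where
  toFun t := fun k => t ^ v k
  map_one' := by ext1 k; simp
  map_mul' t s := by ext1 k; simp [mul_zpow]

/-- For facets `F i` of `P` with facet vectors `lam i`, the subgroup of the torus attached to a
point `p`: it is generated by the circles of the facets that contain `p`, i.e. it is the subgroup
`T(F(p))` of the face `F(p)` that contains `p` in its relative interior. -/
noncomputable def isotropy {P ι κ : Type*} (F : ι → Set P) (lam : ι → κ → ℤ) (p : P) :
    Subgroup (κ → Circle) :=
  ⨆ i ∈ {i : ι | p ∈ F i}, (oneParam (lam i)).range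

/-- The relation on `T × P` with `(t, p) ∼ (s, q)` iff `p = q` and `t⁻¹ s ∈ T(F(p))`. -/
def quasitoricSetoid {P ι κ : Type*} (F : ι → Set P) (lam : ι → κ → ℤ) :
    Setoid ((κ → Circle) × P) where
  r x y := x.2 = y.2 ∧ x.1⁻¹ * y.1 ∈ isotropy F lam x.2
  iseqv :=
    { refl := fun x => ⟨rfl, by simp⟩
      symm := by
        rintro ⟨t, p⟩ ⟨s, q⟩ ⟨h, h'⟩
        obtain rfl : p = q := h
        exact ⟨rfl, by simpa using inv_mem h'⟩
      trans := by
        rintro ⟨t, p⟩ ⟨s, q⟩ ⟨u, r⟩ ⟨h, h'⟩ ⟨k, k'⟩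
        obtain rfl : p = q := h
        obtain rfl : p = r := k
        exact ⟨rfl, by simpa [mul_assoc] using mul_mem h' k'⟩ }

/-- The space `M(lam) = T × P / ∼` with the quotient topology. -/
abbrev QuasitoricSpace {P ι κ : Type*} [TopologicalSpace P] (F : ι → Set P) (lam : ι → κ → ℤ) :
    Type _ :=
  Quotient (quasitoricSetoid F lam)

/-- The polytope `Δⁿ × Δ¹`, each simplex being the standard one in barycentric coordinates. -/
abbrev SimplexProd (n : ℕ) : Type :=
  stdSimplex ℝ (Fin (n + 1)) × stdSimplex ℝ (Fin 2)

/-- The `n + 3` facets of `Δⁿ × Δ¹`: `F_i × Δ¹`, where the `i`-th barycentric coordinate on `Δⁿ`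
vanishes, and `Δⁿ × G_j`, where the `j`-th barycentric coordinate on `Δ¹` vanishes. -/
def simplexProdFacet (n : ℕ) : Fin (n + 1) ⊕ Fin 2 → Set (SimplexProd n)
  | Sum.inl i => {p | p.1.1 i = 0}
  | Sum.inr j => {p | p.2.1 j = 0}

/-- The facet vectors in `ℤⁿ⁺¹`: the first `n` facets `F_i × Δ¹` get `e_i`, the last one
gets `(-1, …, -1, -a)`, the facet `Δⁿ × G_1` gets `e_{n+1}`, and the facet `Δⁿ × G_2` gets
`(-b_1, …, -b_n, -1)`. -/
def facetVector {n : ℕ} (a : ℤ) (b : Fin n → ℤ) : Fin (n + 1) ⊕ Fin 2 → Fin (n + 1) → ℤ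
  | Sum.inl i =>
      Fin.lastCases (motive := fun _ => Fin (n + 1) → ℤ)
        (Fin.snoc (α := fun _ => ℤ) (fun _ => -1) (-a))
        (fun j => Pi.single j.castSucc 1) i
  | Sum.inr 0 => Pi.single (Fin.last n) 1
  | Sum.inr 1 => Fin.snoc (α := fun _ => ℤ) (fun i => -b i) (-1)

/-- The quasitoric manifold `M_{a,b}` over `Δⁿ × Δ¹`. -/
abbrev QuasitoricM {n : ℕ} (a : ℤ) (b : Fin n → ℤ) : Type :=
  QuasitoricSpace (simplexProdFacet n) (facetVector a b)

/-- The vector `(b, 0, …, 0)` in `ℤⁿ`. -/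
def firstVec (n : ℕ) (b : ℤ) : Fin n → ℤ := fun i => if (i : ℕ) = 0 then b else 0

/-!
The homeomorphisms are found upstairs, on the moment-angle manifold `S²ⁿ⁺¹ × S³` of `Δⁿ × Δ¹`.
The kernel of the characteristic homomorphism `Tⁿ⁺³ → Tⁿ⁺¹` is the two-dimensional torus of pairs
`(t, u)`, which acts on `(z, w) ∈ S²ⁿ⁺¹ × S³` by `zᵢ ↦ t u ^ cᵢ zᵢ`, `w₀ ↦ t ^ a u w₀` and
`w₁ ↦ u w₁`, where `c = (b₁, …, bₙ, 0)`. Both `M_{a,b}` and the orbit space of this action are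
quotients of the compact space `Tⁿ⁺³ × (Δⁿ × Δ¹)` with the same fibres, so they are homeomorphic
(`QuasitoricM.nonempty_homeomorph_weightQuotient`). A homeomorphism of `S²ⁿ⁺¹ × S³` that carries
one weighted action to another one, up to an automorphism of the torus, then identifies the two
orbit spaces. Three of them suffice.

* The coordinates of `z` can be permuted, the last one included
  (`WeightQuotient.nonempty_homeomorph_perm`).
* If `a b = 2` and `cᵢ = cⱼ = b`, both weights can be replaced by `0`
  (`WeightQuotient.nonempty_homeomorph_pair`): multiply the quaternion `zᵢ + zⱼ 𝐣` by a unit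
  quaternion whose two complex components are proportional to `conj (w₁ ^ b)` and `w₀ ^ b`. The
  latter has weight `t ^ (a b) u ^ b = t ^ 2 u ^ b`, which is what turns the conjugate of a
  coordinate of weight `t u ^ b` into a coordinate of weight `t`.
* If `a b = 2`, the weights `(b, …, b)` can be replaced by `(0, …, 0)`
  (`WeightQuotient.nonempty_homeomorph_const`): conjugate `w₁` and reparametrise the torus.

By the first two, only the parity of the number of weights `b` matters. If `n` is even, there are
`n + 1` weights in all, an odd number, and the third homeomorphism identifies the two parities.
-/

open scoped ComplexConjugate

/-! ### Weighted torus actions on `S²ⁿ⁺¹ × S³` -/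

/-- The product of spheres `S²ⁿ⁺¹ × S³`, inside `ℂⁿ⁺¹ × ℂ²`. It is the moment-angle manifold of
`Δⁿ × Δ¹`. -/
abbrev SphereProd (n : ℕ) : Type :=
  {z : (Fin (n + 1) → ℂ) × (Fin 2 → ℂ) // ∑ i, ‖z.1 i‖ ^ 2 = 1 ∧ ∑ j, ‖z.2 j‖ ^ 2 = 1}

/-- The orbit relation on `S²ⁿ⁺¹ × S³` of the action of the torus of pairs `(t, u)` which
multiplies `zᵢ` by `t u ^ cᵢ`, the first coordinate of `S³` by `t ^ a u` and the second by `u`. -/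
def weightSetoid {n : ℕ} (a : ℤ) (c : Fin (n + 1) → ℤ) : Setoid (SphereProd n) where
  r z z' := ∃ t u : Circle, (∀ i, z'.1.1 i = (t * u ^ c i : Circle) * z.1.1 i) ∧
    z'.1.2 0 = (t ^ a * u : Circle) * z.1.2 0 ∧ z'.1.2 1 = u * z.1.2 1
  iseqv :=
    { refl := fun z => ⟨1, 1, by simp⟩
      symm := by
        rintro z z' ⟨t, u, h, h0, h1⟩
        refine ⟨t⁻¹, u⁻¹, fun i => ?_, ?_, ?_⟩
        · rw [h, ← mul_assoc, ← Circle.coe_mul,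
            show t⁻¹ * u⁻¹ ^ c i * (t * u ^ c i) = 1 by
              rw [inv_zpow, mul_mul_mul_comm, inv_mul_cancel, inv_mul_cancel, one_mul]]
          simp
        · rw [h0, ← mul_assoc, ← Circle.coe_mul,
            show t⁻¹ ^ a * u⁻¹ * (t ^ a * u) = 1 by
              rw [inv_zpow, mul_mul_mul_comm, inv_mul_cancel, inv_mul_cancel, one_mul]]
          simp
        · rw [h1, ← mul_assoc, ← Circle.coe_mul]
          simp
      trans := by
        rintro z z' z'' ⟨t, u, h, h0, h1⟩ ⟨t', u', h', h0', h1'⟩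
        refine ⟨t' * t, u' * u, fun i => ?_, ?_, ?_⟩
        · rw [h', h, ← mul_assoc, ← Circle.coe_mul, mul_zpow, mul_mul_mul_comm]
        · rw [h0', h0, ← mul_assoc, ← Circle.coe_mul, mul_zpow, mul_mul_mul_comm]
        · rw [h1', h1, ← mul_assoc, ← Circle.coe_mul] }

/-- The orbit space of `S²ⁿ⁺¹ × S³` under the torus action with weights given by `a` and `c`. -/
abbrev WeightQuotient {n : ℕ} (a : ℤ) (c : Fin (n + 1) → ℤ) : Type :=
  Quotient (weightSetoid a c)

/-- A homeomorphism of `S²ⁿ⁺¹ × S³` that matches the orbits of two weighted actions descends to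
the orbit spaces. -/
theorem WeightQuotient.nonempty_homeomorph {n : ℕ} {a : ℤ} {c c' : Fin (n + 1) → ℤ}
    (e : SphereProd n ≃ₜ SphereProd n)
    (h : ∀ z z', weightSetoid a c z z' → weightSetoid a c' (e z) (e z'))
    (h' : ∀ z z', weightSetoid a c' z z' → weightSetoid a c (e.symm z) (e.symm z')) :
    Nonempty (WeightQuotient a c ≃ₜ WeightQuotient a c') :=
  ⟨{ toEquiv := Quotient.congr e.toEquiv fun z z' =>
        ⟨h z z', fun hz => by simpa using h' _ _ hz⟩
     continuous_toFun := Continuous.quotient_map' e.continuous h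
     continuous_invFun := Continuous.quotient_map' e.symm.continuous h' }⟩

/-- Permuting the coordinates of `S²ⁿ⁺¹` permutes the weights. -/
theorem WeightQuotient.nonempty_homeomorph_perm {n : ℕ} (a : ℤ) (c : Fin (n + 1) → ℤ)
    (σ : Equiv.Perm (Fin (n + 1))) :
    Nonempty (WeightQuotient a c ≃ₜ WeightQuotient a (c ∘ σ)) := by
  refine nonempty_homeomorph
    { toFun := fun z => ⟨(z.1.1 ∘ σ, z.1.2),
        by simpa using (Equiv.sum_comp σ fun i => ‖z.1.1 i‖ ^ 2).trans z.2.1, z.2.2⟩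
      invFun := fun z => ⟨(z.1.1 ∘ σ.symm, z.1.2),
        by simpa using (Equiv.sum_comp σ.symm fun i => ‖z.1.1 i‖ ^ 2).trans z.2.1, z.2.2⟩
      left_inv := fun z => by ext <;> simp
      right_inv := fun z => by ext <;> simp
      continuous_toFun := by dsimp only [Function.comp_def]; fun_prop
      continuous_invFun := by dsimp only [Function.comp_def]; fun_prop } ?_ ?_
  · rintro z z' ⟨t, u, h, h0, h1⟩
    exact ⟨t, u, fun i => h (σ i), h0, h1⟩
  · rintro z z' ⟨t, u, h, h0, h1⟩
    exact ⟨t, u, fun i => by simpa using h (σ.symm i), h0, h1⟩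

/-- Conjugating the last coordinate of `S³` turns the weights `(b, …, b)` into `(0, …, 0)`: the
torus is reparametrised by `(t, u) ↦ (t u ^ b, u⁻¹)`, and `(t u ^ b) ^ a u⁻¹ = t ^ a u`
because `a b = 2`. -/
theorem WeightQuotient.nonempty_homeomorph_const {n : ℕ} {a b : ℤ} (hab : a * b = 2) :
    Nonempty (WeightQuotient a (fun _ : Fin (n + 1) => b) ≃ₜ
      WeightQuotient a (0 : Fin (n + 1) → ℤ)) := by
  let f : SphereProd n → SphereProd n := fun z =>
    ⟨(z.1.1, ![z.1.2 0, conj (z.1.2 1)]), z.2.1, by simpa [Fin.sum_univ_two] using z.2.2⟩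
  have hf : Function.Involutive f := fun z => by
    refine Subtype.ext (Prod.ext rfl ?_)
    ext j; fin_cases j <;> simp [f]
  have hc : Continuous f := by
    refine Continuous.subtype_mk (Continuous.prodMk (by fun_prop) (continuous_pi fun j => ?_)) _
    fin_cases j
    · simp only [Fin.zero_eta, Matrix.cons_val_zero]; fun_prop
    · simp only [Fin.mk_one, Matrix.cons_val_one, Matrix.cons_val_fin_one]
      exact Complex.continuous_conj.comp (by fun_prop)
  have key : ∀ t u : Circle, (t * u ^ b) ^ a * u⁻¹ = t ^ a * u := fun t u => by
    rw [mul_zpow, ← zpow_mul, mul_comm b a, hab, mul_assoc]; group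
  refine nonempty_homeomorph ⟨hf.toPerm, hc, hc⟩ ?_ ?_
  · rintro z z' ⟨t, u, h, h0, h1⟩
    change weightSetoid a _ (f z) (f z')
    refine ⟨t * u ^ b, u⁻¹, fun i => ?_, ?_, ?_⟩
    · simpa [f] using h i
    · rw [key]; simpa [f] using h0
    · simp [f, h1, ← Circle.coe_inv_eq_conj]
  · rintro z z' ⟨t, u, h, h0, h1⟩
    change weightSetoid a _ (f z) (f z')
    refine ⟨t * u ^ b, u⁻¹, fun i => ?_, ?_, ?_⟩
    · rw [inv_zpow, mul_inv_cancel_right]; simpa [f] using h i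
    · rw [key]; simpa [f] using h0
    · simp [f, h1, ← Circle.coe_inv_eq_conj]

/-! ### The quaternionic twist of two coordinates -/

/-- The integral power of a complex number in which conjugation replaces inversion: `w ^ b` for
`b ≥ 0` and `(conj w) ^ (-b)` for `b < 0`. -/
noncomputable def conjPow (b : ℤ) (w : ℂ) : ℂ :=
  if 0 ≤ b then w ^ b.natAbs else conj w ^ b.natAbs

theorem continuous_conjPow (b : ℤ) : Continuous (conjPow b) := by
  unfold conjPow
  split_ifs
  · fun_prop
  · exact Complex.continuous_conj.pow _

theorem conjPow_ne_zero {w : ℂ} (hw : w ≠ 0) (b : ℤ) : conjPow b w ≠ 0 := by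
  unfold conjPow
  split_ifs
  · exact pow_ne_zero _ hw
  · exact pow_ne_zero _ ((map_ne_zero _).2 hw)

theorem conjPow_circle_mul (b : ℤ) (k : Circle) (w : ℂ) :
    conjPow b (k * w) = (k ^ b : Circle) * conjPow b w := by
  unfold conjPow
  split_ifs with hb
  · obtain ⟨m, rfl⟩ := Int.eq_ofNat_of_zero_le hb
    simp [mul_pow]
  · obtain ⟨m, hm⟩ := Int.eq_ofNat_of_zero_le (by omega : 0 ≤ -b)
    obtain rfl : b = -(m : ℤ) := by omega
    simp [mul_pow, ← Circle.coe_inv_eq_conj]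

/-- Left multiplication of the quaternion `zᵢ + zⱼ 𝐣` by `α - β 𝐣`, in complex coordinates (where
`𝐣 z = conj z 𝐣`); the other coordinates of `z` are fixed. -/
noncomputable def quatTwist {m : ℕ} (i j : Fin m) (α β : ℂ) (z : Fin m → ℂ) (k : Fin m) : ℂ :=
  if k = i then α * z i + β * conj (z j)
  else if k = j then α * z j - β * conj (z i) else z k

theorem sum_norm_quatTwist {m : ℕ} {i j : Fin m} (hij : i ≠ j) {α β : ℂ}
    (h : ‖α‖ ^ 2 + ‖β‖ ^ 2 = 1) (z : Fin m → ℂ) :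
    ∑ k, ‖quatTwist i j α β z k‖ ^ 2 = ∑ k, ‖z k‖ ^ 2 := by
  have hj : j ∈ Finset.univ.erase i := by simp [hij.symm]
  rw [← Finset.add_sum_erase _ _ (Finset.mem_univ i), ← Finset.add_sum_erase _ _ hj,
    ← Finset.add_sum_erase (Finset.univ) (fun k => ‖z k‖ ^ 2) (Finset.mem_univ i),
    ← Finset.add_sum_erase _ (fun k => ‖z k‖ ^ 2) hj, ← add_assoc, ← add_assoc]
  congr 1
  · simp only [quatTwist, if_true, hij.symm, if_false]
    simp only [← Complex.normSq_eq_norm_sq, Complex.normSq_apply] at h ⊢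
    simp
    linear_combination ((z i).re * (z i).re + (z i).im * (z i).im + (z j).re * (z j).re
      + (z j).im * (z j).im) * h
  · refine Finset.sum_congr rfl fun k hk => ?_
    simp only [Finset.mem_erase] at hk
    simp [quatTwist, hk.1, hk.2.1]

/-- The inverse of a unit quaternion is its conjugate: `α - β 𝐣` has inverse `conj α + β 𝐣`. -/
theorem quatTwist_conj_neg {m : ℕ} {i j : Fin m} (hij : i ≠ j) {α β : ℂ}
    (h : ‖α‖ ^ 2 + ‖β‖ ^ 2 = 1) (z : Fin m → ℂ) :
    quatTwist i j (conj α) (-β) (quatTwist i j α β z) = z := by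
  have h' : conj α * α + β * conj β = 1 := by
    rw [Complex.conj_mul', Complex.mul_conj']; exact_mod_cast h
  ext k
  by_cases hki : k = i
  · subst hki
    simp only [quatTwist, if_true, hij.symm, if_false]
    simp
    linear_combination z k * h'
  by_cases hkj : k = j
  · subst hkj
    simp only [quatTwist, if_true, hki, if_false]
    simp
    linear_combination z k * h'
  · simp [quatTwist, hki, hkj]

/-- The twist intertwines two diagonal torus actions with weights `χ` and `χ'` when its
coefficients have weights `μ` and `ν`. -/
theorem quatTwist_circle_mul {m : ℕ} {i j : Fin m} (α β : ℂ) (μ ν : Circle)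
    (χ χ' : Fin m → Circle) (hi : μ * χ i = χ' i) (hj : μ * χ j = χ' j)
    (hi' : ν * (χ j)⁻¹ = χ' i) (hj' : ν * (χ i)⁻¹ = χ' j)
    (hk : ∀ k, k ≠ i → k ≠ j → χ k = χ' k) (z : Fin m → ℂ) (k : Fin m) :
    quatTwist i j (μ * α) (ν * β) (fun l => χ l * z l) k = χ' k * quatTwist i j α β z k := by
  have e1 := congrArg (fun x : Circle => (x : ℂ)) hi
  have e2 := congrArg (fun x : Circle => (x : ℂ)) hj
  have e3 := congrArg (fun x : Circle => (x : ℂ)) hi'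
  have e4 := congrArg (fun x : Circle => (x : ℂ)) hj'
  simp only [Circle.coe_mul, Circle.coe_inv_eq_conj] at e1 e2 e3 e4
  by_cases hki : k = i
  · subst hki
    simp only [quatTwist, if_true, map_mul]
    linear_combination α * z k * e1 + β * conj (z j) * e3
  by_cases hkj : k = j
  · subst hkj
    simp only [quatTwist, if_true, hki, if_false, map_mul]
    linear_combination α * z k * e2 - β * conj (z i) * e4
  · simp [quatTwist, hki, hkj, hk k hki hkj]

/-- The norm of `(w₀ ^ b, w₁ ^ b)`, powers being taken with `conjPow`. -/
noncomputable def conjPowNorm (b : ℤ) (w : Fin 2 → ℂ) : ℝ :=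
  √(‖conjPow b (w 0)‖ ^ 2 + ‖conjPow b (w 1)‖ ^ 2)

theorem conjPowNorm_pos (b : ℤ) {w : Fin 2 → ℂ} (hw : ∑ j, ‖w j‖ ^ 2 = 1) :
    0 < conjPowNorm b w := by
  refine Real.sqrt_pos.2 ?_
  by_cases h0 : w 0 = 0
  · have h1 : w 1 ≠ 0 := fun h1 => by simp [Fin.sum_univ_two, h0, h1] at hw
    have := norm_pos_iff.2 (conjPow_ne_zero h1 b)
    positivity
  · have := norm_pos_iff.2 (conjPow_ne_zero h0 b)
    positivity

/-- Two weights `b` cancel when `a b = 2`. On `S²ⁿ⁺¹ × S³`, with `w` the point of `S³`, the twist by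
`α = conj (w₁ ^ b)` and `β = w₀ ^ b`, scaled to `|α|² + |β|² = 1`, turns the coordinates `zᵢ` and
`zⱼ` of weight `t u ^ b` into coordinates of weight `t`: the coefficients `α` and `β` have weights
`u ^ (-b)` and `(t ^ a u) ^ b = t ^ 2 u ^ b`. -/
theorem WeightQuotient.nonempty_homeomorph_pair {n : ℕ} {a b : ℤ} (hab : a * b = 2)
    {c c' : Fin (n + 1) → ℤ} {i j : Fin (n + 1)} (hij : i ≠ j) (hi : c i = b) (hj : c j = b)
    (hi' : c' i = 0) (hj' : c' j = 0) (hk : ∀ k, k ≠ i → k ≠ j → c k = c' k) :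
    Nonempty (WeightQuotient a c ≃ₜ WeightQuotient a c') := by
  let α : (Fin 2 → ℂ) → ℂ := fun w => conj (conjPow b (w 1)) / conjPowNorm b w
  let β : (Fin 2 → ℂ) → ℂ := fun w => conjPow b (w 0) / conjPowNorm b w
  have hN : Continuous (conjPowNorm b) := by
    have := continuous_conjPow b
    unfold conjPowNorm
    fun_prop
  have hα : Continuous fun z : SphereProd n => α z.1.2 := by
    refine Continuous.div ?_ ?_ fun z => Complex.ofReal_ne_zero.2 (conjPowNorm_pos b z.2.2).ne'
    · exact Complex.continuous_conj.comp ((continuous_conjPow b).comp (by fun_prop))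
    · exact Complex.continuous_ofReal.comp (hN.comp (by fun_prop))
  have hβ : Continuous fun z : SphereProd n => β z.1.2 := by
    refine Continuous.div ?_ ?_ fun z => Complex.ofReal_ne_zero.2 (conjPowNorm_pos b z.2.2).ne'
    · exact (continuous_conjPow b).comp (by fun_prop)
    · exact Complex.continuous_ofReal.comp (hN.comp (by fun_prop))
  have hαβ : ∀ w : Fin 2 → ℂ, ∑ j, ‖w j‖ ^ 2 = 1 → ‖α w‖ ^ 2 + ‖β w‖ ^ 2 = 1 := fun w hw => by
    have h0 := conjPowNorm_pos b hw
    have h2 : conjPowNorm b w ^ 2 = ‖conjPow b (w 0)‖ ^ 2 + ‖conjPow b (w 1)‖ ^ 2 :=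
      Real.sq_sqrt (by positivity)
    simp only [α, β, norm_div, RCLike.norm_conj, Complex.norm_real, Real.norm_eq_abs,
      abs_of_pos h0, div_pow]
    rw [← add_div, add_comm, ← h2, div_self (by positivity)]
  have hαβ' : ∀ w : Fin 2 → ℂ, ∑ j, ‖w j‖ ^ 2 = 1 → ‖conj (α w)‖ ^ 2 + ‖-β w‖ ^ 2 = 1 :=
    fun w hw => by simpa using hαβ w hw
  have hcont : ∀ γ δ : SphereProd n → ℂ, Continuous γ → Continuous δ →
      Continuous fun z : SphereProd n => quatTwist i j (γ z) (δ z) z.1.1 := fun γ δ hγ hδ => by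
    refine continuous_pi fun k => ?_
    have hconj : ∀ l, Continuous fun z : SphereProd n => conj (z.1.1 l) := fun l =>
      Complex.continuous_conj.comp (by fun_prop)
    unfold quatTwist
    split_ifs
    · exact (hγ.mul (by fun_prop)).add (hδ.mul (hconj j))
    · exact (hγ.mul (by fun_prop)).sub (hδ.mul (hconj i))
    · fun_prop
  let e : SphereProd n ≃ₜ SphereProd n :=
    { toFun := fun z => ⟨(quatTwist i j (α z.1.2) (β z.1.2) z.1.1, z.1.2),
        (sum_norm_quatTwist hij (hαβ _ z.2.2) _).trans z.2.1, z.2.2⟩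
      invFun := fun z => ⟨(quatTwist i j (conj (α z.1.2)) (-β z.1.2) z.1.1, z.1.2),
        (sum_norm_quatTwist hij (hαβ' _ z.2.2) _).trans z.2.1, z.2.2⟩
      left_inv := fun z => Subtype.ext
        (Prod.ext (quatTwist_conj_neg hij (hαβ _ z.2.2) _) rfl)
      right_inv := fun z => Subtype.ext
        (Prod.ext (by simpa using quatTwist_conj_neg hij (hαβ' _ z.2.2) z.1.1) rfl)
      continuous_toFun := ((hcont _ _ hα hβ).prodMk (by fun_prop)).subtype_mk _
      continuous_invFun := ((hcont _ _ (Complex.continuous_conj.comp hα) hβ.neg).prodMk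
        (by fun_prop)).subtype_mk _ }
  have hNk : ∀ (w w' : Fin 2 → ℂ) (k₀ k₁ : Circle), w' 0 = k₀ * w 0 → w' 1 = k₁ * w 1 →
      conjPowNorm b w' = conjPowNorm b w := fun w w' k₀ k₁ h0 h1 => by
    simp only [conjPowNorm, h0, h1, conjPow_circle_mul, norm_mul, Circle.norm_coe, one_mul]
  have hαk : ∀ (w w' : Fin 2 → ℂ) (k₀ k₁ : Circle), w' 0 = k₀ * w 0 → w' 1 = k₁ * w 1 →
      α w' = (k₁ ^ (-b) : Circle) * α w := fun w w' k₀ k₁ h0 h1 => by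
    simp only [α, hNk w w' k₀ k₁ h0 h1, h1, conjPow_circle_mul, map_mul,
      ← Circle.coe_inv_eq_conj, zpow_neg, mul_div_assoc]
  have hβk : ∀ (w w' : Fin 2 → ℂ) (k₀ k₁ : Circle), w' 0 = k₀ * w 0 → w' 1 = k₁ * w 1 →
      β w' = (k₀ ^ b : Circle) * β w := fun w w' k₀ k₁ h0 h1 => by
    simp only [β, hNk w w' k₀ k₁ h0 h1, h0, conjPow_circle_mul, mul_div_assoc]
  have hk₀ : ∀ t u : Circle, (t ^ a * u) ^ b = t * (t * u ^ b) := fun t u => by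
    rw [mul_zpow, ← zpow_mul, hab, ← mul_assoc, zpow_two]
  refine nonempty_homeomorph e ?_ ?_
  · rintro z z' ⟨t, u, h, h0, h1⟩
    refine ⟨t, u, fun k => ?_, h0, h1⟩
    change quatTwist i j (α z'.1.2) (β z'.1.2) z'.1.1 k =
      (t * u ^ c' k : Circle) * quatTwist i j (α z.1.2) (β z.1.2) z.1.1 k
    rw [hαk _ _ _ _ h0 h1, hβk _ _ _ _ h0 h1, funext h]
    refine quatTwist_circle_mul _ _ _ _ (fun k => t * u ^ c k)
      (fun k => t * u ^ c' k) ?_ ?_ ?_ ?_ ?_ _ _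
    · simp only [hi, hi', zpow_neg, zpow_zero]; rw [mul_left_comm, inv_mul_cancel]
    · simp only [hj, hj', zpow_neg, zpow_zero]; rw [mul_left_comm, inv_mul_cancel]
    · simp only [hj, hi', hk₀, zpow_zero]; rw [mul_inv_cancel_right, mul_one]
    · simp only [hi, hj', hk₀, zpow_zero]; rw [mul_inv_cancel_right, mul_one]
    · intro k hki hkj; simp only [hk k hki hkj]
  · rintro z z' ⟨t, u, h, h0, h1⟩
    refine ⟨t, u, fun k => ?_, h0, h1⟩
    change quatTwist i j (conj (α z'.1.2)) (-β z'.1.2) z'.1.1 k =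
      (t * u ^ c k : Circle) * quatTwist i j (conj (α z.1.2)) (-β z.1.2) z.1.1 k
    rw [hαk _ _ _ _ h0 h1, hβk _ _ _ _ h0 h1, funext h, map_mul, ← Circle.coe_inv_eq_conj,
      ← mul_neg]
    refine quatTwist_circle_mul _ _ _ _ (fun k => t * u ^ c' k)
      (fun k => t * u ^ c k) ?_ ?_ ?_ ?_ ?_ _ _
    · simp only [hi, hi', zpow_neg, zpow_zero, inv_inv]; rw [mul_one, mul_comm]
    · simp only [hj, hj', zpow_neg, zpow_zero, inv_inv]; rw [mul_one, mul_comm]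
    · simp only [hi, hj', hk₀, zpow_zero]; rw [mul_one, mul_comm, inv_mul_cancel_left]
    · simp only [hj, hi', hk₀, zpow_zero]; rw [mul_one, mul_comm, inv_mul_cancel_left]
    · intro k hki hkj; simp only [hk k hki hkj]

/-! ### Quasitoric spaces as quotients of moment-angle manifolds -/

/-- The characteristic homomorphism `(S¹)^ι → (S¹)^κ` which sends the circle of the facet `i` to
the one-parameter subgroup of its facet vector. -/
noncomputable def charHom {ι κ : Type*} [Fintype ι] (lam : ι → κ → ℤ) :
    (ι → Circle) →* (κ → Circle) where
  toFun x := ∏ i, oneParam (lam i) (x i)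
  map_one' := by simp
  map_mul' x y := by simp [Finset.prod_mul_distrib]

theorem charHom_apply {ι κ : Type*} [Fintype ι] (lam : ι → κ → ℤ) (x : ι → Circle) (k : κ) :
    charHom lam x k = ∏ i, x i ^ lam i k := by
  simp [charHom, oneParam]

theorem continuous_charHom {ι κ : Type*} [Fintype ι] (lam : ι → κ → ℤ) :
    Continuous (charHom lam) := by
  refine continuous_pi fun k => ?_
  simp only [charHom_apply]
  exact continuous_finsetProd _ fun i _ => (continuous_apply i).zpow _

/-- The isotropy group at `p` is the image under the characteristic homomorphism of the coordinate
subtorus of the facets through `p`. -/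
theorem mem_isotropy_iff {P ι κ : Type*} [Fintype ι] (F : ι → Set P) (lam : ι → κ → ℤ) (p : P)
    (g : κ → Circle) :
    g ∈ isotropy F lam p ↔ ∃ x : ι → Circle, (∀ i, p ∉ F i → x i = 1) ∧ charHom lam x = g := by
  classical
  constructor
  · let S : Subgroup (ι → Circle) :=
      { carrier := {x | ∀ i, p ∉ F i → x i = 1}
        mul_mem' := fun hx hy i hi => by simp [hx i hi, hy i hi]
        one_mem' := fun i _ => rfl
        inv_mem' := fun hx i hi => by simp [hx i hi] }
    have hle : isotropy F lam p ≤ S.map (charHom lam) := by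
      refine iSup₂_le fun i hi => ?_
      rintro _ ⟨t, rfl⟩
      refine ⟨Pi.mulSingle i t, fun j hj => Pi.mulSingle_eq_of_ne ?_ _, ?_⟩
      · rintro rfl
        exact hj hi
      · ext1 k
        rw [charHom_apply, Finset.prod_eq_single i]
        · simp [oneParam]
        · intro j _ hj
          simp [Pi.mulSingle_eq_of_ne hj]
        · simp
    exact fun hg => hle hg
  · rintro ⟨x, hx, rfl⟩
    refine Subgroup.prod_mem _ fun i _ => ?_
    by_cases hi : p ∈ F i
    · exact Subgroup.mem_iSup_of_mem i (Subgroup.mem_iSup_of_mem hi ⟨x i, rfl⟩)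
    · simp [hx i hi]

/-- The element of `Tⁿ⁺³` by which `(t, u)` acts on `S²ⁿ⁺¹ × S³`. -/
noncomputable def weightElement {n : ℕ} (a : ℤ) (c : Fin (n + 1) → ℤ) (t u : Circle) :
    Fin (n + 1) ⊕ Fin 2 → Circle :=
  Sum.elim (fun i => t * u ^ c i) ![t ^ a * u, u]

theorem charHom_facetVector_castSucc {n : ℕ} (a : ℤ) (b : Fin n → ℤ)
    (x : Fin (n + 1) ⊕ Fin 2 → Circle) (i : Fin n) :
    charHom (facetVector a b) x i.castSucc =
      x (.inl i.castSucc) * (x (.inl (Fin.last n)))⁻¹ * (x (.inr 1) ^ b i)⁻¹ := by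
  rw [charHom_apply, Fintype.prod_sum_type, Fin.prod_univ_castSucc, Fin.prod_univ_two,
    Finset.prod_eq_single i]
  · simp [facetVector, (Fin.castSucc_lt_last i).ne]
  · intro j _ hj
    simp [facetVector, hj.symm]
  · simp

theorem charHom_facetVector_last {n : ℕ} (a : ℤ) (b : Fin n → ℤ)
    (x : Fin (n + 1) ⊕ Fin 2 → Circle) :
    charHom (facetVector a b) x (Fin.last n) =
      (x (.inl (Fin.last n)) ^ a)⁻¹ * x (.inr 0) * (x (.inr 1))⁻¹ := by
  rw [charHom_apply, Fintype.prod_sum_type, Fin.prod_univ_castSucc, Fin.prod_univ_two,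
    Finset.prod_eq_one]
  · simp [facetVector, mul_assoc]
  · intro j _
    simp [facetVector, (Fin.castSucc_lt_last j).ne']

theorem charHom_facetVector_surjective {n : ℕ} (a : ℤ) (b : Fin n → ℤ) :
    Function.Surjective (charHom (facetVector a b)) := fun g => by
  refine ⟨Sum.elim (Fin.snoc (α := fun _ => Circle) (fun i => g i.castSucc) 1)
    ![g (Fin.last n), 1], ?_⟩
  ext1 k
  refine Fin.lastCases ?_ (fun i => ?_) k
  · simp [charHom_facetVector_last]
  · simp [charHom_facetVector_castSucc]

/-- The kernel of the characteristic homomorphism of `M_{a,b}` is the two-dimensional torus of the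
weighted action with weights `(b₁, …, bₙ, 0)`. -/
theorem charHom_facetVector_eq_one_iff {n : ℕ} (a : ℤ) (b : Fin n → ℤ)
    (x : Fin (n + 1) ⊕ Fin 2 → Circle) :
    charHom (facetVector a b) x = 1 ↔
      ∃ t u, x = weightElement a (Fin.snoc (α := fun _ => ℤ) b 0) t u := by
  constructor
  · intro h
    refine ⟨x (.inl (Fin.last n)), x (.inr 1), ?_⟩
    ext1 k
    obtain k | k := k
    · refine Fin.lastCases ?_ (fun i => ?_) k
      · simp [weightElement]
      · have := congrFun h i.castSucc
        rw [charHom_facetVector_castSucc, Pi.one_apply, mul_inv_eq_one, mul_inv_eq_iff_eq_mul]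
          at this
        simp [weightElement, this, mul_comm]
    · fin_cases k
      · have := congrFun h (Fin.last n)
        rw [charHom_facetVector_last, Pi.one_apply, mul_inv_eq_one, inv_mul_eq_iff_eq_mul] at this
        simp [weightElement, this]
      · simp [weightElement]
  · rintro ⟨t, u, rfl⟩
    ext1 k
    refine Fin.lastCases ?_ (fun i => ?_) k
    · simp [charHom_facetVector_last, weightElement]
    · simp [charHom_facetVector_castSucc, weightElement]

/-- The polar coordinate map `T × P → S²ⁿ⁺¹ × S³`: a point with barycentric coordinates `pᵢ`
provides the radii `√pᵢ`. -/
noncomputable def polarMap {n : ℕ} (y : (Fin (n + 1) ⊕ Fin 2 → Circle) × SimplexProd n) :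
    SphereProd n :=
  ⟨(fun i => y.1 (.inl i) * (√(y.2.1.1 i) : ℝ), fun j => y.1 (.inr j) * (√(y.2.2.1 j) : ℝ)), by
    simp only [norm_mul, Circle.norm_coe, one_mul, Complex.norm_real, Real.norm_eq_abs, sq_abs]
    exact ⟨by simp_rw [Real.sq_sqrt (y.2.1.2.1 _)]; exact y.2.1.2.2,
      by simp_rw [Real.sq_sqrt (y.2.2.2.1 _)]; exact y.2.2.2.2⟩⟩

theorem continuous_polarMap {n : ℕ} : Continuous (polarMap (n := n)) := by
  have h1 : ∀ k : Fin (n + 1) ⊕ Fin 2,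
      Continuous fun y : (Fin (n + 1) ⊕ Fin 2 → Circle) × SimplexProd n => ((y.1 k : Circle) : ℂ) :=
    fun k => continuous_subtype_val.comp ((continuous_apply k).comp continuous_fst)
  have h2 : ∀ i, Continuous fun y : (Fin (n + 1) ⊕ Fin 2 → Circle) × SimplexProd n =>
      ((√(y.2.1.1 i) : ℝ) : ℂ) := fun i =>
    Complex.continuous_ofReal.comp (Real.continuous_sqrt.comp ((continuous_apply i).comp
      (continuous_subtype_val.comp (continuous_fst.comp continuous_snd))))
  have h3 : ∀ j, Continuous fun y : (Fin (n + 1) ⊕ Fin 2 → Circle) × SimplexProd n =>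
      ((√(y.2.2.1 j) : ℝ) : ℂ) := fun j =>
    Complex.continuous_ofReal.comp (Real.continuous_sqrt.comp ((continuous_apply j).comp
      (continuous_subtype_val.comp (continuous_snd.comp continuous_snd))))
  exact Continuous.subtype_mk (Continuous.prodMk (continuous_pi fun i => (h1 _).mul (h2 i))
    (continuous_pi fun j => (h1 _).mul (h3 j))) _

theorem exists_circle_mul_norm (z : ℂ) : ∃ x : Circle, z = x * (‖z‖ : ℝ) := by
  refine ⟨Circle.exp z.arg, ?_⟩
  rw [Circle.coe_exp, mul_comm, Complex.norm_mul_exp_arg_mul_I]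

theorem polarMap_surjective {n : ℕ} : Function.Surjective (polarMap (n := n)) := fun z => by
  choose x hx using fun i => exists_circle_mul_norm (z.1.1 i)
  choose y hy using fun j => exists_circle_mul_norm (z.1.2 j)
  refine ⟨(Sum.elim x y, ⟨fun i => ‖z.1.1 i‖ ^ 2, fun i => by positivity, z.2.1⟩,
    ⟨fun j => ‖z.1.2 j‖ ^ 2, fun j => by positivity, z.2.2⟩), Subtype.ext (Prod.ext ?_ ?_)⟩
  · ext i
    simpa [polarMap, Real.sqrt_sq] using (hx i).symm
  · ext j
    simpa [polarMap, Real.sqrt_sq] using (hy j).symm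

theorem circle_mul_sqrt_eq_iff (x y k : Circle) {p q : ℝ} (hp : 0 ≤ p) (hq : 0 ≤ q) :
    (y * (√q : ℝ) : ℂ) = k * (x * (√p : ℝ)) ↔ p = q ∧ (p ≠ 0 → y = k * x) := by
  constructor
  · intro h
    have hpq : p = q := by
      have := congrArg norm h
      simp only [norm_mul, Circle.norm_coe, one_mul, Complex.norm_real, Real.norm_eq_abs,
        abs_of_nonneg (Real.sqrt_nonneg _)] at this
      exact ((Real.sqrt_inj hq hp).1 this).symm
    subst hpq
    refine ⟨rfl, fun h0 => Circle.ext ?_⟩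
    have hs : ((√p : ℝ) : ℂ) ≠ 0 :=
      Complex.ofReal_ne_zero.2 (Real.sqrt_ne_zero'.2 (hp.lt_of_ne' h0))
    rw [← mul_assoc] at h
    simpa using mul_right_cancel₀ hs h
  · rintro ⟨rfl, h⟩
    by_cases h0 : p = 0
    · simp [h0]
    · rw [h h0, Circle.coe_mul, mul_assoc]

/-- Two points of `T × P` lie over one orbit if and only if they have the same barycentric
coordinates and their torus components differ by the torus action, except possibly in the entries
of the facets through the point, whose circles are collapsed. -/
theorem weightSetoid_polarMap_iff {n : ℕ} (a : ℤ) (c : Fin (n + 1) → ℤ)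
    (x y : Fin (n + 1) ⊕ Fin 2 → Circle) (p q : SimplexProd n) :
    weightSetoid a c (polarMap (x, p)) (polarMap (y, q)) ↔
      p = q ∧ ∃ t u, ∀ k, p ∉ simplexProdFacet n k → y k = weightElement a c t u k * x k := by
  constructor
  · rintro ⟨t, u, h, h0, h1⟩
    replace h := fun i => (circle_mul_sqrt_eq_iff _ _ _ (p.1.2.1 i) (q.1.2.1 i)).1 (h i)
    replace h0 := (circle_mul_sqrt_eq_iff _ _ _ (p.2.2.1 0) (q.2.2.1 0)).1 h0
    replace h1 := (circle_mul_sqrt_eq_iff _ _ _ (p.2.2.1 1) (q.2.2.1 1)).1 h1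
    refine ⟨Prod.ext (Subtype.ext (funext fun i => (h i).1))
      (Subtype.ext (funext fun j => ?_)), t, u, ?_⟩
    · fin_cases j
      exacts [h0.1, h1.1]
    · rintro (i | j) hk
      · exact (h i).2 hk
      · fin_cases j
        exacts [h0.2 hk, h1.2 hk]
  · rintro ⟨rfl, t, u, h⟩
    exact ⟨t, u, fun i => (circle_mul_sqrt_eq_iff _ _ _ (p.1.2.1 i) (p.1.2.1 i)).2
        ⟨rfl, h (.inl i)⟩,
      (circle_mul_sqrt_eq_iff _ _ _ (p.2.2.1 0) (p.2.2.1 0)).2 ⟨rfl, h (.inr 0)⟩,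
      (circle_mul_sqrt_eq_iff _ _ _ (p.2.2.1 1) (p.2.2.1 1)).2 ⟨rfl, h (.inr 1)⟩⟩

/-- Two quotient maps with the same fibres have homeomorphic targets. -/
theorem Topology.IsQuotientMap.nonempty_homeomorph {X Y Z : Type*} [TopologicalSpace X]
    [TopologicalSpace Y] [TopologicalSpace Z] {f : X → Y} {g : X → Z} (hf : IsQuotientMap f)
    (hg : IsQuotientMap g) (h : ∀ x y, f x = f y ↔ g x = g y) : Nonempty (Y ≃ₜ Z) := by
  have hk : Setoid.ker f = Setoid.ker g := Setoid.ext h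
  have e := Topology.IsQuotientMap.homeomorph (f := ⟨f, hf.continuous⟩) hf
  have e' := Topology.IsQuotientMap.homeomorph (f := ⟨g, hg.continuous⟩) hg
  change Quotient (Setoid.ker f) ≃ₜ Y at e
  change Quotient (Setoid.ker g) ≃ₜ Z at e'
  rw [hk] at e
  exact ⟨e.symm.trans e'⟩

/-- `M_{a,b}` is the quotient of `S²ⁿ⁺¹ × S³` by the kernel of its characteristic homomorphism:
both spaces are quotients of `Tⁿ⁺³ × P`, with the same fibres. -/
theorem QuasitoricM.nonempty_homeomorph_weightQuotient {n : ℕ} (a : ℤ) (b : Fin n → ℤ) :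
    Nonempty (QuasitoricM a b ≃ₜ WeightQuotient a (Fin.snoc (α := fun _ => ℤ) b 0)) := by
  let φ := charHom (facetVector a b)
  let f : (Fin (n + 1) ⊕ Fin 2 → Circle) × SimplexProd n →
    (Fin (n + 1) → Circle) × SimplexProd n := Prod.map φ id
  have hfc : Continuous f := (continuous_charHom _).prodMap continuous_id
  have hf : Topology.IsQuotientMap f := hfc.isClosedMap.isQuotientMap hfc
    ((charHom_facetVector_surjective a b).prodMap Function.surjective_id)
  have hg : Topology.IsQuotientMap (polarMap (n := n)) :=
    continuous_polarMap.isClosedMap.isQuotientMap continuous_polarMap polarMap_surjective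
  refine Topology.IsQuotientMap.nonempty_homeomorph
    ((isQuotientMap_quotient_mk' (s := quasitoricSetoid (simplexProdFacet n)
      (facetVector a b))).comp hf)
    ((isQuotientMap_quotient_mk' (s := weightSetoid a (Fin.snoc (α := fun _ => ℤ) b 0))).comp hg)
    ?_
  rintro ⟨x, p⟩ ⟨y, q⟩
  refine Quotient.eq.trans (Iff.trans ?_ Quotient.eq.symm)
  refine Iff.trans ?_ (weightSetoid_polarMap_iff a _ x y p q).symm
  change p = q ∧ (φ x)⁻¹ * φ y ∈ isotropy _ _ p ↔ _
  rw [mem_isotropy_iff]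
  refine and_congr_right fun _ => ?_
  constructor
  · rintro ⟨v, hv, hvφ⟩
    have h1 : φ (y * v⁻¹ * x⁻¹) = 1 := by
      rw [map_mul, map_mul, map_inv, map_inv, show φ v = _ from hvφ]
      group
    obtain ⟨t, u, h⟩ := (charHom_facetVector_eq_one_iff a b _).1 h1
    refine ⟨t, u, fun k hk => ?_⟩
    rw [← h]
    simp [hv k hk]
  · rintro ⟨t, u, h⟩
    have h1 := (charHom_facetVector_eq_one_iff a b _).2 ⟨t, u, rfl⟩
    refine ⟨(weightElement a (Fin.snoc (α := fun _ => ℤ) b 0) t u)⁻¹ * x⁻¹ * y, fun k hk => ?_, ?_⟩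
    · rw [Pi.mul_apply, Pi.mul_apply, Pi.inv_apply, Pi.inv_apply, h k hk, ← mul_inv,
        inv_mul_cancel]
    · rw [map_mul, map_mul, map_inv, map_inv, h1, inv_one, one_mul]

/-! ### Reduction of the weights by parity -/

/-- The weights equal to `b` on `S` and to `0` elsewhere. -/
def subsetWeight {m : ℕ} (b : ℤ) (S : Finset (Fin m)) : Fin m → ℤ := fun i => if i ∈ S then b else 0

/-- The orbit space depends only on the number of weights that equal `b`. -/
theorem WeightQuotient.nonempty_homeomorph_of_card_eq {n : ℕ} (a b : ℤ)
    {S S' : Finset (Fin (n + 1))} (h : S.card = S'.card) :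
    Nonempty (WeightQuotient a (subsetWeight b S) ≃ₜ WeightQuotient a (subsetWeight b S')) := by
  obtain ⟨σ, hσ⟩ : ∃ σ : Equiv.Perm (Fin (n + 1)), ∀ i, σ i ∈ S ↔ i ∈ S' := by
    let e : {i // i ∈ S'} ≃ {i // i ∈ S} := Finset.equivOfCardEq h.symm
    exact ⟨e.extendSubtype, fun i => ⟨fun hi => by
      by_contra hn
      exact e.extendSubtype_not_mem i hn hi, e.extendSubtype_mem i⟩⟩
  have hS : subsetWeight b S' = subsetWeight b S ∘ σ := by
    ext i
    simp [subsetWeight, hσ]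
  rw [hS]
  exact nonempty_homeomorph_perm a _ σ

/-- Only the parity of the number of weights `b` matters, as they cancel in pairs. -/
theorem WeightQuotient.nonempty_homeomorph_of_even_iff {n : ℕ} {a b : ℤ} (hab : a * b = 2)
    {S S' : Finset (Fin (n + 1))} (h : Even S.card ↔ Even S'.card) :
    Nonempty (WeightQuotient a (subsetWeight b S) ≃ₜ WeightQuotient a (subsetWeight b S')) := by
  wlog hle : S'.card ≤ S.card generalizing S S'
  · obtain ⟨e⟩ := this h.symm (by omega)
    exact ⟨e.symm⟩
  induction hS : S.card using Nat.strong_induction_on generalizing S with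
  | _ m ih =>
    obtain heq | hlt := hle.eq_or_lt
    · exact nonempty_homeomorph_of_card_eq a b heq.symm
    have h2 : S'.card + 2 ≤ S.card := by
      by_contra hn
      have : S.card = S'.card + 1 := by omega
      rw [this, Nat.even_add_one] at h
      tauto
    obtain ⟨i, hi, j, hj, hij⟩ := Finset.one_lt_card.1 (by omega : 1 < S.card)
    have hj' : j ∈ S.erase i := Finset.mem_erase.2 ⟨hij.symm, hj⟩
    have hcard : ((S.erase i).erase j).card + 2 = S.card := by
      rw [Finset.card_erase_of_mem hj', Finset.card_erase_of_mem hi]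
      omega
    obtain ⟨e⟩ : Nonempty (WeightQuotient a (subsetWeight b S) ≃ₜ
        WeightQuotient a (subsetWeight b ((S.erase i).erase j))) :=
      nonempty_homeomorph_pair hab hij (by simp [subsetWeight, hi]) (by simp [subsetWeight, hj])
        (by simp [subsetWeight]) (by simp [subsetWeight])
        fun k hki hkj => by simp [subsetWeight, hki, hkj]
    obtain ⟨e'⟩ := ih _ (by omega) (S := (S.erase i).erase j)
      (by rw [← h, ← hcard, Nat.even_add]; simp) (by omega) rfl
    exact ⟨e.trans e'⟩

/-- If `n + 1` is odd, then `n + 1` weights `b` reduce both to one of them, by cancellation in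
pairs, and to none of them, by reparametrisation of the torus. -/
theorem WeightQuotient.nonempty_homeomorph_of_even {n : ℕ} {a b : ℤ} (hab : a * b = 2)
    (hn : Even n) (S S' : Finset (Fin (n + 1))) :
    Nonempty (WeightQuotient a (subsetWeight b S) ≃ₜ WeightQuotient a (subsetWeight b S')) := by
  have hzero : ∀ S : Finset (Fin (n + 1)),
      Nonempty (WeightQuotient a (subsetWeight b S) ≃ₜ WeightQuotient a
        (subsetWeight b (∅ : Finset (Fin (n + 1))))) := by
    intro S
    by_cases hS : Even S.card
    · exact nonempty_homeomorph_of_even_iff hab (by simpa using hS)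
    · obtain ⟨e⟩ := nonempty_homeomorph_of_even_iff hab (S := S) (S' := Finset.univ)
        (by simp [hS, Nat.even_add_one, hn])
      obtain ⟨e'⟩ := nonempty_homeomorph_const (n := n) hab
      have h1 : subsetWeight b (Finset.univ : Finset (Fin (n + 1))) = fun _ => b := by
        ext; simp [subsetWeight]
      have h0 : subsetWeight b (∅ : Finset (Fin (n + 1))) = 0 := by ext; simp [subsetWeight]
      rw [h1] at e
      rw [h0]
      exact ⟨e.trans e'⟩
  obtain ⟨e⟩ := hzero S
  obtain ⟨e'⟩ := hzero S'
  exact ⟨e.trans e'.symm⟩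

/-- For facet vectors with parameters in `{0, b}`, the space `M_{a,v}` is the orbit space of the
weights supported on the set of indices `i` with `vᵢ = b`. -/
theorem QuasitoricM.nonempty_homeomorph_subsetWeight {n : ℕ} (a : ℤ) {b : ℤ} {v : Fin n → ℤ}
    (hv : ∀ i, v i = b ∨ v i = 0) :
    Nonempty (QuasitoricM a v ≃ₜ WeightQuotient a (subsetWeight b
      ((Finset.univ.filter fun i => v i = b).map Fin.castSuccEmb))) := by
  have hS : subsetWeight b ((Finset.univ.filter fun i => v i = b).map Fin.castSuccEmb) =
      Fin.snoc (α := fun _ => ℤ) v 0 := by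
    ext k
    refine Fin.lastCases ?_ (fun i => ?_) k
    · simp [subsetWeight]
    · obtain h | h := hv i <;> simp [subsetWeight, h, eq_comm]
  rw [hS]
  exact nonempty_homeomorph_weightQuotient a v

theorem QuasitoricM.nonempty_homeomorph_of_even_iff {n : ℕ} {a b : ℤ} (hab : a * b = 2)
    {v v' : Fin n → ℤ} (hv : ∀ i, v i = b ∨ v i = 0) (hv' : ∀ i, v' i = b ∨ v' i = 0)
    (h : Even n ∨ (Even (Finset.univ.filter fun i => v i = b).card ↔
      Even (Finset.univ.filter fun i => v' i = b).card)) :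
    Nonempty (QuasitoricM a v ≃ₜ QuasitoricM a v') := by
  obtain ⟨e⟩ := nonempty_homeomorph_subsetWeight a hv
  obtain ⟨e'⟩ := nonempty_homeomorph_subsetWeight a hv'
  obtain ⟨e''⟩ := h.elim
    (fun hn => WeightQuotient.nonempty_homeomorph_of_even hab hn
      ((Finset.univ.filter fun i => v i = b).map Fin.castSuccEmb)
      ((Finset.univ.filter fun i => v' i = b).map Fin.castSuccEmb))
    (fun h => WeightQuotient.nonempty_homeomorph_of_even_iff hab (by simpa using h))
  exact ⟨(e.trans e'').trans e'.symm⟩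

theorem mainTheorem10 (n : ℕ) (hn : 1 < n) (a b : ℤ) (hab : a * b = 2) :
    Nonempty (QuasitoricM a (firstVec n b) ≃ₜ QuasitoricM a (fun _ : Fin n => b)) ∧
    ∀ (v : Fin n → ℤ), (∀ i, v i = b ∨ v i = 0) →
      (Even (Finset.univ.filter (fun i => v i = b)).card →
        Nonempty (QuasitoricM a v ≃ₜ QuasitoricM a (0 : Fin n → ℤ))) ∧
      (Odd (Finset.univ.filter (fun i => v i = b)).card →
        Nonempty (QuasitoricM a v ≃ₜ QuasitoricM a (firstVec n b))) ∧
      (Even n → Nonempty (QuasitoricM a v ≃ₜ QuasitoricM a (0 : Fin n → ℤ))) := by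
  have hb : b ≠ 0 := by rintro rfl; simp at hab
  have hfirst : ∀ i, firstVec n b i = b ∨ firstVec n b i = 0 := fun i => by
    unfold firstVec; split_ifs <;> simp
  have hcard : (Finset.univ.filter fun i => firstVec n b i = b).card = 1 := by
    refine Finset.card_eq_one.2 ⟨⟨0, by omega⟩, ?_⟩
    ext i
    simp [firstVec, Fin.ext_iff, hb.symm]
  have hcard0 : (Finset.univ.filter fun i => (0 : Fin n → ℤ) i = b).card = 0 := by
    simp [hb.symm]
  refine ⟨?_, fun v hv => ⟨fun h => ?_, fun h => ?_, fun h => ?_⟩⟩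
  · refine QuasitoricM.nonempty_homeomorph_of_even_iff hab hfirst (fun _ => .inl rfl) ?_
    rw [hcard]
    simp only [Finset.filter_true, Finset.card_univ, Fintype.card_fin, Nat.not_even_one,
      false_iff]
    exact em _
  · exact QuasitoricM.nonempty_homeomorph_of_even_iff hab hv (fun _ => .inr rfl)
      (.inr (by rw [hcard0]; simpa using h))
  · exact QuasitoricM.nonempty_homeomorph_of_even_iff hab hv hfirst
      (.inr (by simp [hcard, h]))
  · exact QuasitoricM.nonempty_homeomorph_of_even_iff hab hv (fun _ => .inr rfl) (.inl h)
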